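/- Let $p$ be a prime, let $s,r,m\ge 1$ be integers, put $q=p^r$ and $n=q^m-1$, and let $L=GR(p^s,r)$ be the Galois ring of characteristic $p^s$ and cardinality $p^{sr}$, i.e. a finite commutative local ring of this characteristic and cardinality with maximal ideal $pL$. Then its residue field $\mathbb{F}_q=L/pL$ has $q$ elements; write $\alpha:L\to\mathbb{F}_q$ for reduction modulo $p$, and also for the induced coordinatewise map $L^{q^m}\to\mathbb{F}_q^{q^m}$ and the coefficientwise map $L[x]\to\mathbb{F}_q[x]$. Let $h(x)\in L[x]$ be a monic basic primitive polynomial of degree $m$ (i.e. monic with $\bar h=\alpha(h)$ a primitive polynomial over $\mathbb{F}_q$) dividing $x^{n}-1$, whose root $\xi$, the class of $x$ in $L[x]/(h)=GR(p^s,rm)$, has order $n$. Let $b_\infty=0\in L^m$ and, for $0\le i\le n-1$, let $b_i=(b_{1i},\dots,b_{mi})\in L^m$ be the coordinate vector of $\xi^i$, that is, $\xi^i=b_{1i}+b_{2i}\xi+\dots+b_{mi}\xi^{m-1}$. For $0\le\nu\le m(q-1)$ let $$RM_L(\nu,m)=\{(P(b_\infty),P(b_0),\dots,P(b_{n-1}))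 : P\in L[x_1,\dots,x_m],\ \deg_{x_j}P\le q-1\ (1\le j\le m),\ \deg P\le\nu\}.$$ Let $\beta_\infty=0$ and let $\beta_i\in\mathbb{F}_q^m$ be the coordinate vector of $\bar\xi^{\,i}$ in the basis $1,\bar\xi,\dots,\bar\xi^{\,m-1}$ of $\mathbb{F}_q[x]/(\bar h)$, where $\bar\xi$ is the class of $x$ ($0\le i\le n-1$). Then $\beta_\infty,\beta_0,\dots,\beta_{n-1}$ is an enumeration of all the points of $\mathbb{F}_q^m$ without repetition, and $$\alpha(RM_L(\nu,m))=RM_{\mathbb{F}_q}(\nu,m),$$ where $RM_{\mathbb{F}_q}(\nu,m)=\{(f(\beta_\infty),f(\beta_0),\dots,f(\beta_{n-1})) : f\in\mathbb{F}_q[x_1,\dots,x_m],\ \deg f\le\nu\}$ is the usual generalized Reed-Muller code of order $\nu$ and length $q^m$ over $\mathbb{F}_q$. -/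

import Mathlib

open Polynomial

/-- `L` is the Galois ring `GR(p^s, r)`: a finite commutative local ring of characteristic `p^s`
and cardinality `p^(s r)` whose maximal ideal is generated by `p`. -/
structure IsGaloisRing (p s r : ℕ) (L : Type*) [CommRing L] [IsLocalRing L] : Prop where
  charP : CharP L (p ^ s)
  card : Nat.card L = p ^ (s * r)
  maximalIdeal_eq : IsLocalRing.maximalIdeal L = Ideal.span {(p : L)}

/-- A primitive polynomial over a finite field `F`: a monic irreducible polynomial `f` such that
the class of `x` in the field `F[x]/(f)` generates its multiplicative group, that is, has order
`|F|^(deg f) - 1`. -/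
structure IsPrimitivePolynomial {F : Type*} [Field F] (f : F[X]) : Prop where
  monic : f.Monic
  irreducible : Irreducible f
  orderOf_root : orderOf (AdjoinRoot.root f) = Nat.card F ^ f.natDegree - 1

/-- A monic basic primitive polynomial over a local ring: a monic polynomial whose reduction
modulo the maximal ideal is a primitive polynomial over the residue field. -/
structure IsMonicBasicPrimitive {L : Type*} [CommRing L] [IsLocalRing L] (h : L[X]) : Prop where
  monic : h.Monic
  primitive : IsPrimitivePolynomial (h.map (IsLocalRing.residue L))

/-- The coordinates `(c_0, …, c_{m-1})` of an element of `R[x]/(h)`, `h` monic of degree `m`, in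
the basis `1, ξ, …, ξ^(m-1)`, where `ξ` is the class of `x`. -/
noncomputable def rootCoords {R : Type*} [CommRing R] {h : R[X]} (hh : h.Monic) (m : ℕ)
    (a : AdjoinRoot h) : Fin m → R :=
  fun j => (AdjoinRoot.modByMonicHom hh a).coeff j

theorem sum_rootCoords {R : Type*} [CommRing R] {h : R[X]} (hh : h.Monic)
    (a : AdjoinRoot h) :
    a = ∑ j : Fin h.natDegree, rootCoords hh h.natDegree a j • AdjoinRoot.root h ^ (j : ℕ) := by
  rcases subsingleton_or_nontrivial R with hR | hR
  · have : Subsingleton (AdjoinRoot h) := (AdjoinRoot.mk_surjective (g := h)).subsingleton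
    exact Subsingleton.elim _ _
  · have h1 := (AdjoinRoot.powerBasis' hh).basis.sum_repr a
    have h2 : ∀ j, (AdjoinRoot.powerBasis' hh).basis.repr a j
        = (AdjoinRoot.modByMonicHom hh a).coeff j := fun j => rfl
    conv_lhs => rw [← h1]
    simp only [PowerBasis.basis_eq_pow, AdjoinRoot.powerBasis'_gen, h2]
    rfl

/-- The points `b_∞ = 0, b_0, b_1, …, b_{n-1}` of `R^m`, where `b_i` is the coordinate vector of
`ξ^i` in the basis `1, ξ, …, ξ^(m-1)` of `R[x]/(h)`. The index `∞` is `none`. -/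
noncomputable def powerPoints {R : Type*} [CommRing R] {h : R[X]} (hh : h.Monic) (m n : ℕ) :
    Option (Fin n) → Fin m → R
  | none => 0
  | some i => rootCoords hh m (AdjoinRoot.root h ^ (i : ℕ))

/-- The evaluation map `P ↦ (P(b_i))_i` on polynomials in `m` variables. -/
noncomputable def evMap {R : Type*} [CommRing R] {m : ℕ} {ι : Type*} (b : ι → Fin m → R) :
    MvPolynomial (Fin m) R →ₗ[R] (ι → R) :=
  LinearMap.pi fun i => (MvPolynomial.aeval (b i)).toLinearMap

/-- The generalized Reed-Muller code `RM_L(ν, m)` of length `n + 1 = q^m`: all tuples `ev(P)` where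
`P` has degree at most `q - 1` in each variable and total degree at most `ν`. -/
noncomputable def ringGRM {L : Type*} [CommRing L] {h : L[X]} (hh : h.Monic) (q m ν : ℕ) :
    Submodule L (Option (Fin (q ^ m - 1)) → L) :=
  (MvPolynomial.restrictDegree (Fin m) L (q - 1) ⊓
    MvPolynomial.restrictTotalDegree (Fin m) L ν).map (evMap (powerPoints hh m (q ^ m - 1)))

/-- The usual generalized Reed-Muller code of order `ν` over a finite field `F`: all tuples of
values of the polynomials in `m` variables of total degree at most `ν` at all the points of `F^m`,
listed by the enumeration `e`. -/
noncomputable def fieldGRM {F : Type*} [Field F] {m : ℕ} {ι : Type*} (e : ι ≃ (Fin m → F))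
    (ν : ℕ) : Submodule F (ι → F) :=
  (MvPolynomial.restrictTotalDegree (Fin m) F ν).map (evMap e)

/-- The projection map `α` on tuples: coordinatewise reduction modulo the maximal ideal. -/
noncomputable def reduceTuple {L : Type*} [CommRing L] [IsLocalRing L] {ι : Type*} (v : ι → L) :
    ι → IsLocalRing.ResidueField L :=
  fun i => IsLocalRing.residue L (v i)

/-! Division with remainder by a monic polynomial commutes with reduction, so each `b_i` reduces to
`β_i`, and reducing `ev(P)` gives the values of the reduced polynomial at the `β_i`; its degree has
not grown, whence one inclusion. Conversely, `x ^ q = x` on the residue field lets exponents drop to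
at most `q - 1` without changing values or raising the degree, and coefficients lift along the
surjection (`exists_reduced_lift`). Primitivity makes the `β_i` distinct, and counting makes them
exhaust the space. -/

/-- In a local ring whose maximal ideal is generated by `π`, the ideals `(π ^ i)` have index
`|k| ^ i`, as long as the powers of `π` do not vanish before. -/
theorem index_span_pow_eq {L : Type*} [CommRing L] [IsLocalRing L] {π : L}
    (hmax : IsLocalRing.maximalIdeal L = Ideal.span {π}) {s : ℕ} (hπ : ∀ i < s, π ^ i ≠ 0) :
    ∀ i ≤ s, (Ideal.span {π ^ i}).toAddSubgroup.index =
      Nat.card (IsLocalRing.ResidueField L) ^ i := by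
  intro i
  induction i with
  | zero =>
    intro _
    have : (Ideal.span {π ^ 0}).toAddSubgroup = (⊤ : AddSubgroup L) := by
      simp [Ideal.span_singleton_one]
    rw [this]
    simp
  | succ i ih =>
    intro hi
    have hle : (Ideal.span {π ^ (i + 1)}).toAddSubgroup ≤ (Ideal.span {π ^ i}).toAddSubgroup :=
      Ideal.span_singleton_le_span_singleton.2 (pow_dvd_pow π (Nat.le_succ i))
    have hrange : (AddMonoidHom.mulLeft (π ^ i)).range = (Ideal.span {π ^ i}).toAddSubgroup := by
      ext x
      simp [Ideal.mem_span_singleton, dvd_def, eq_comm]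
    -- Multiplication by `π ^ i` thus identifies `L/(π)` with `(π ^ i)/(π ^ (i + 1))`, so each step
    -- multiplies the index by `|k|`.
    have hcomap : (Ideal.span {π ^ (i + 1)}).toAddSubgroup.comap (AddMonoidHom.mulLeft (π ^ i)) =
        (IsLocalRing.maximalIdeal L).toAddSubgroup := by
      ext x
      simp only [AddSubgroup.mem_comap, AddMonoidHom.coe_mulLeft, Submodule.mem_toAddSubgroup,
        Ideal.mem_span_singleton]
      constructor
      · rintro ⟨y, hy⟩
        by_contra hx
        -- `π ^ i` kills this element, so were it a unit, `π ^ i` would vanish.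
        have hunit : IsUnit (x - π * y) := by
          by_contra hnu
          refine hx ?_
          have h1 : x - π * y ∈ IsLocalRing.maximalIdeal L := hnu
          have h2 : π * y ∈ IsLocalRing.maximalIdeal L := by
            rw [hmax]
            exact Ideal.mul_mem_right _ _ (Ideal.mem_span_singleton_self π)
          simpa using add_mem h1 h2
        refine hπ i hi ((hunit.mul_left_eq_zero).1 ?_)
        rw [mul_sub, hy]
        ring
      · intro hx
        rw [hmax, Ideal.mem_span_singleton] at hx
        rw [pow_succ]
        exact mul_dvd_mul_left _ hx
    have hidx := AddSubgroup.index_comap (Ideal.span {π ^ (i + 1)}).toAddSubgroup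
      (AddMonoidHom.mulLeft (π ^ i))
    rw [hcomap, hrange] at hidx
    rw [← AddSubgroup.relIndex_mul_index hle, ← hidx, ih (Nat.le_of_succ_le hi), pow_succ']
    rfl

/-- Since `p ^ s = 0`, the index of `(p ^ s)` is `|L| = p ^ (s * r)`, and it is also `|k| ^ s`;
compare `s`-th roots. -/
theorem IsGaloisRing.card_residueField {p s r : ℕ} (hp : p.Prime) (hs : 1 ≤ s)
    {L : Type*} [CommRing L] [IsLocalRing L] (hL : IsGaloisRing p s r L) :
    Nat.card (IsLocalRing.ResidueField L) = p ^ r := by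
  have := hL.charP
  have hne : ∀ i < s, (p : L) ^ i ≠ 0 := by
    intro i hi h0
    have h1 : ((p ^ i : ℕ) : L) = 0 := by exact_mod_cast h0
    rw [CharP.cast_eq_zero_iff L (p ^ s), Nat.pow_dvd_pow_iff_le_right hp.one_lt] at h1
    omega
  have h0 : (p : L) ^ s = 0 := by exact_mod_cast CharP.cast_eq_zero L (p ^ s)
  have h := index_span_pow_eq hL.maximalIdeal_eq hne s le_rfl
  have hbot : (Ideal.span {(p : L) ^ s}).toAddSubgroup = (⊥ : AddSubgroup L) := by
    rw [h0, Ideal.span_singleton_eq_bot.2 rfl]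
    rfl
  rw [hbot, AddSubgroup.index_bot, hL.card, mul_comm, pow_mul] at h
  exact (Nat.pow_left_injective (by omega) h).symm

theorem rootCoords_injective {R : Type*} [CommRing R] {h : R[X]} (hh : h.Monic) {m : ℕ}
    (hm : h.natDegree = m) : Function.Injective (rootCoords hh m) := by
  subst hm
  intro a b hab
  rw [sum_rootCoords hh a, sum_rootCoords hh b, hab]

theorem rootCoords_map {R S : Type*} [CommRing R] [CommRing S] (f : R →+* S) {h : R[X]}
    (hh : h.Monic) (hh' : (h.map f).Monic) (m i : ℕ) (j : Fin m) :
    f (rootCoords hh m (AdjoinRoot.root h ^ i) j) =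
      rootCoords hh' m (AdjoinRoot.root (h.map f) ^ i) j := by
  have h1 : AdjoinRoot.root h ^ i = AdjoinRoot.mk h (X ^ i) := by simp
  have h2 : AdjoinRoot.root (h.map f) ^ i = AdjoinRoot.mk (h.map f) (X ^ i) := by simp
  rw [rootCoords, rootCoords, h1, h2, AdjoinRoot.modByMonicHom_mk, AdjoinRoot.modByMonicHom_mk,
    ← Polynomial.coeff_map, Polynomial.map_modByMonic f hh, Polynomial.map_pow, Polynomial.map_X]

theorem powerPoints_map {R S : Type*} [CommRing R] [CommRing S] (f : R →+* S) {h : R[X]}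
    (hh : h.Monic) (hh' : (h.map f).Monic) (m n : ℕ) (i : Option (Fin n)) (j : Fin m) :
    f (powerPoints hh m n i j) = powerPoints hh' m n i j := by
  cases i with
  | none => simp [powerPoints]
  | some i => exact rootCoords_map f hh hh' m i j

theorem powerPoints_bijective {F : Type*} [Field F] [Finite F] {f : F[X]}
    (hf : IsPrimitivePolynomial f) {m : ℕ} (hm : f.natDegree = m) :
    Function.Bijective (powerPoints hf.monic m (Nat.card F ^ m - 1)) := by
  have := Fact.mk hf.irreducible
  have := Fintype.ofFinite F
  have hinj := rootCoords_injective hf.monic hm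
  have hzero : rootCoords hf.monic m 0 = 0 := by
    funext j
    simp [rootCoords]
  have hroot : AdjoinRoot.root f ≠ 0 := by
    intro h0
    have h1 := hf.orderOf_root
    have h2 : 1 < Nat.card F ^ f.natDegree :=
      Nat.one_lt_pow hf.irreducible.natDegree_pos.ne' Finite.one_lt_card
    have h3 := pow_orderOf_eq_one (AdjoinRoot.root f)
    -- The order is positive, and a positive power of `0` cannot be `1`.
    rw [h0, zero_pow (by rw [← h0, h1]; omega)] at h3
    exact zero_ne_one h3
  rw [Fintype.bijective_iff_injective_and_card]
  constructor
  · intro i j hij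
    match i, j, hij with
    | none, none, _ => rfl
    | none, some j, hij =>
      exact absurd (hinj (hzero.trans hij)).symm (pow_ne_zero _ hroot)
    | some i, none, hij =>
      exact absurd (hinj (hij.trans hzero.symm)) (pow_ne_zero _ hroot)
    | some i, some j, hij =>
      have hord := hf.orderOf_root
      rw [hm] at hord
      have := pow_injOn_Iio_orderOf (x := AdjoinRoot.root f)
        (by rw [hord]; exact i.2) (by rw [hord]; exact j.2) (hinj hij)
      rw [Fin.ext this]
  · have : 0 < Nat.card F ^ m := pow_pos Nat.card_pos m
    rw [Fintype.card_option, Fintype.card_fin, Fintype.card_fun, Fintype.card_fin,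
      ← Nat.card_eq_fintype_card]
    omega

/-- Subtract `q - 1` only while `k ≥ q`: a positive exponent then stays positive, so the values at
`x = 0` agree too. -/
theorem exists_reduced_exponent {F : Type*} [Field F] [Finite F] (k : ℕ) :
    ∃ l ≤ Nat.card F - 1, l ≤ k ∧ ∀ x : F, x ^ l = x ^ k := by
  have := Fintype.ofFinite F
  have hF : 1 < Nat.card F := Finite.one_lt_card
  induction k using Nat.strong_induction_on with
  | _ k ih =>
    by_cases hk : k ≤ Nat.card F - 1
    · exact ⟨k, hk, le_rfl, fun _ => rfl⟩
    · obtain ⟨l, hl, hlk, hx⟩ := ih (k - (Nat.card F - 1)) (by omega)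
      refine ⟨l, hl, by omega, fun x => ?_⟩
      rw [hx x]
      have hk' : k = k - Nat.card F + Nat.card F := by omega
      have hk'' : k - (Nat.card F - 1) = k - Nat.card F + 1 := by omega
      conv_rhs => rw [hk', pow_add, Nat.card_eq_fintype_card, FiniteField.pow_card]
      rw [hk'', pow_succ, Nat.card_eq_fintype_card]

theorem exists_reduced_multiexponent {F : Type*} [Field F] [Finite F] {m : ℕ} (d : Fin m →₀ ℕ) :
    ∃ d' : Fin m →₀ ℕ, (∀ j, d' j ≤ Nat.card F - 1) ∧ d'.degree ≤ d.degree ∧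
      ∀ x : Fin m → F, ∏ j, x j ^ d' j = ∏ j, x j ^ d j := by
  choose l hl hlk hx using fun k => exists_reduced_exponent (F := F) k
  refine ⟨Finsupp.equivFunOnFinite.symm fun j => l (d j), fun j => hl _, ?_, fun x => ?_⟩
  · simp only [Finsupp.degree_eq_sum]
    exact Finset.sum_le_sum fun j _ => hlk (d j)
  · exact Finset.prod_congr rfl fun j _ => hx _ _

/-- If `π : R → F` is a surjection onto a finite field, every polynomial of total degree `≤ ν` over
`F` has the same values as the reduction of a polynomial over `R` of total degree `≤ ν` and of
degree `< |F|` in each variable. -/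
theorem exists_reduced_lift {R F : Type*} [CommRing R] [Field F] [Finite F] {π : R →+* F}
    (hπ : Function.Surjective π) {m ν : ℕ} {f : MvPolynomial (Fin m) F}
    (hf : f ∈ MvPolynomial.restrictTotalDegree (Fin m) F ν) :
    ∃ P ∈ MvPolynomial.restrictDegree (Fin m) R (Nat.card F - 1) ⊓
        MvPolynomial.restrictTotalDegree (Fin m) R ν,
      ∀ x : Fin m → F, MvPolynomial.eval₂ π x P = MvPolynomial.eval x f := by
  choose red h1 h2 h3 using fun d => exists_reduced_multiexponent (F := F) (m := m) d
  choose lift hlift using hπ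
  -- Distinct `d` may share the same `red d`; a sum of monomials absorbs such collisions.
  refine ⟨∑ d ∈ f.support, MvPolynomial.monomial (red d) (lift (f.coeff d)),
    Submodule.sum_mem _ fun d hd => ⟨?_, ?_⟩, fun x => ?_⟩
  · rw [SetLike.mem_coe, MvPolynomial.mem_restrictDegree]
    intro t ht j
    rw [Finset.mem_singleton.1 (MvPolynomial.support_monomial_subset ht)]
    exact h1 d j
  · rw [SetLike.mem_coe, MvPolynomial.mem_restrictTotalDegree]
    rw [MvPolynomial.mem_restrictTotalDegree] at hf
    refine (MvPolynomial.totalDegree_monomial_le _ _).trans ((h2 d).trans (le_trans ?_ hf))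
    exact MvPolynomial.le_totalDegree hd
  · rw [MvPolynomial.eval₂_sum, MvPolynomial.eval_eq']
    refine Finset.sum_congr rfl fun d _ => ?_
    rw [MvPolynomial.eval₂_monomial, hlift, ← h3, Finsupp.prod_fintype _ _ fun _ => pow_zero _]

theorem reduceTuple_evMap {L : Type*} [CommRing L] [IsLocalRing L] {m : ℕ} {ι : Type*}
    {b : ι → Fin m → L} {β : ι → Fin m → IsLocalRing.ResidueField L}
    (hb : ∀ i j, IsLocalRing.residue L (b i j) = β i j) (P : MvPolynomial (Fin m) L) (i : ι) :
    reduceTuple (evMap b P) i = MvPolynomial.eval₂ (IsLocalRing.residue L) (β i) P := by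
  have hβ : β i = IsLocalRing.residue L ∘ b i := funext fun j => (hb i j).symm
  rw [hβ]
  exact MvPolynomial.eval₂_comp_left (IsLocalRing.residue L) (RingHom.id L) (b i) P

theorem mainTheorem7 {p s r m : ℕ} (hp : p.Prime) (hs : 1 ≤ s) (hr : 1 ≤ r) (hm : 1 ≤ m)
    {L : Type*} [CommRing L] [IsLocalRing L] (hL : IsGaloisRing p s r L)
    {h : L[X]} (hh : IsMonicBasicPrimitive h) (hdeg : h.natDegree = m)
    (hdvd : h ∣ X ^ ((p ^ r) ^ m - 1) - 1)
    (hord : orderOf (AdjoinRoot.root h) = (p ^ r) ^ m - 1)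
    {ν : ℕ} (hν : ν ≤ m * (p ^ r - 1)) :
    Nat.card (IsLocalRing.ResidueField L) = p ^ r ∧
    ∃ e : Option (Fin ((p ^ r) ^ m - 1)) ≃ (Fin m → IsLocalRing.ResidueField L),
      (∀ i, e i = powerPoints hh.primitive.monic m ((p ^ r) ^ m - 1) i) ∧
      reduceTuple '' (ringGRM hh.monic (p ^ r) m ν : Set (Option (Fin ((p ^ r) ^ m - 1)) → L)) =
        (fieldGRM e ν :
          Set (Option (Fin ((p ^ r) ^ m - 1)) → IsLocalRing.ResidueField L)) := by
  have hcard := hL.card_residueField hp hs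
  have hfin : Finite (IsLocalRing.ResidueField L) :=
    Nat.finite_of_card_ne_zero (by rw [hcard]; exact pow_ne_zero _ hp.ne_zero)
  have hbij := powerPoints_bijective hh.primitive
    ((hh.monic.natDegree_map (IsLocalRing.residue L)).trans hdeg)
  rw [hcard] at hbij
  refine ⟨hcard, Equiv.ofBijective _ hbij, fun _ => rfl, ?_⟩
  have hred := fun P => reduceTuple_evMap
    (powerPoints_map (IsLocalRing.residue L) hh.monic hh.primitive.monic m ((p ^ r) ^ m - 1)) P
  ext v
  constructor
  · rintro ⟨_, ⟨P, ⟨-, hP⟩, rfl⟩, rfl⟩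
    refine ⟨MvPolynomial.map (IsLocalRing.residue L) P, ?_, funext fun i => ?_⟩
    · rw [SetLike.mem_coe, MvPolynomial.mem_restrictTotalDegree] at hP ⊢
      exact (Finset.sup_mono (MvPolynomial.support_map_subset _ P)).trans hP
    · rw [hred, ← MvPolynomial.eval_map]
      rfl
  · rintro ⟨f, hf, rfl⟩
    obtain ⟨P, hP, hPf⟩ := exists_reduced_lift (IsLocalRing.residue_surjective (R := L)) hf
    rw [hcard] at hP
    exact ⟨_, ⟨P, hP, rfl⟩, funext fun i => (hred P i).trans (hPf _)⟩
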